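/- **Theorem (real $t$-Jordan canonical form).** Let $n,p\ge 1$. A tensor $\mathcal A\in\mathbb R^{n\times n\times p}$ is given by its frontal slices $A^{(1)},\dots,A^{(p)}\in\mathbb R^{n\times n}$. The $t$-product of $\mathcal A,\mathcal B\in\mathbb R^{n\times n\times p}$ is $$\mathcal A*\mathcal B=\mathrm{fold}\big(\mathrm{bcirc}(\mathcal A)\,\mathrm{unfold}(\mathcal B)\big),$$ where $\mathrm{unfold}(\mathcal B)$ is the $np\times n$ matrix obtained by stacking $B^{(1)},\dots,B^{(p)}$ vertically, $\mathrm{fold}$ is the inverse of $\mathrm{unfold}$, and $\mathrm{bcirc}(\mathcal A)$ is the block-circulant $np\times np$ matrix whose $(k,l)$ block is $A^{(r)}$, with $r\in\{1,\dots,p\}$ and $r\equiv k-l+1 \pmod p$. The identity tensor $\mathcal I$ has $I^{(1)}=I_n$ and $I^{(k)}=0$ for $k\ge2$. A tensor $\mathcal P\in\mathbb R^{n\times n\times p}$ is $t$-invertible if there is a (necessarily unique) tensor $\mathcal P^{-1}\in\mathbb R^{n\times n\times p}$ with $\mathcal P*\mathcal P^{-1}=\mathcal P^{-1}*\mathcal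 P=\mathcal I$. A matrix $J\in\mathbb R^{n\times n}$ is upper block-bi-diagonal if there is a partition $n=n_1+\dots+n_r$ into consecutive blocks with $n_j\in\{1,2\}$ such that, in the corresponding block decomposition of $J$, only the diagonal blocks $J_{ii}$ (of size $n_i\times n_i$) and the first superdiagonal blocks $J_{i,i+1}$ (of size $n_i\times n_{i+1}$) may be nonzero. A tensor is $f$-upper-block-bi-diagonal if each of its frontal slices is upper block-bi-diagonal. Then for every $\mathcal A\in\mathbb R^{n\times n\times p}$ there exist a $t$-invertible tensor $\mathcal P\in\mathbb R^{n\times n\times p}$ and an $f$-upper-block-bi-diagonal tensor $\mathcal J\in\mathbb R^{n\times n\times p}$ such that $$\mathcal A=\mathcal P*\mathcal J*\mathcal P^{-1}.$$ Moreover, each frontal slice of $\mathcal J$ is upper block-bi-diagonal, with diagonal and first superdiagonal blocks of size at most $2\times2$. -/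

import Mathlib

namespace TProduct

/-- Third-order tensors of size `m × n × p`, given by their frontal slices: the entry `(i, j, k)` of
`A` is `A k i j`. Slices are indexed from `0`, so `A 0` is the first frontal slice. -/
abbrev Tensor (F : Type*) (m n p : ℕ) : Type _ := Fin p → Matrix (Fin m) (Fin n) F

/-- The frontal slices of a tensor, stacked on top of each other. -/
def unfold {F : Type*} {m n p : ℕ} (A : Tensor F m n p) : Matrix (Fin p × Fin m) (Fin n) F :=
  Matrix.of fun r j => A r.1 r.2 j

/-- The inverse of `unfold`. -/
def fold {F : Type*} {m n p : ℕ} (M : Matrix (Fin p × Fin m) (Fin n) F) : Tensor F m n p :=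
  fun k => Matrix.of fun i j => M (k, i) j

/-- The block-circulant matrix of a tensor; its block in block row `k` and block column `l` is
the slice with index `k - l` modulo `p`. -/
def bcirc {F : Type*} {m n p : ℕ} (A : Tensor F m n p) :
    Matrix (Fin p × Fin m) (Fin p × Fin n) F :=
  Matrix.of fun r s => A (r.1 - s.1) r.2 s.2

/-- The t-product `A * B = fold (bcirc A · unfold B)`. -/
def tProd {F : Type*} [CommRing F] {m n l p : ℕ} (A : Tensor F m n p) (B : Tensor F n l p) :
    Tensor F m l p :=
  fold (bcirc A * unfold B)

/-- The identity tensor: the first frontal slice is the identity matrix, the others vanish. -/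
def tOne (F : Type*) [CommRing F] (n p : ℕ) [NeZero p] : Tensor F n n p :=
  fun k => if k = 0 then 1 else 0

/-- `X` is the t-inverse of `A`. -/
def IsTInverse {F : Type*} [CommRing F] {n p : ℕ} [NeZero p] (A X : Tensor F n n p) : Prop :=
  tProd A X = tOne F n p ∧ tProd X A = tOne F n p

/-- `A` is t-invertible. -/
def IsTInvertible {F : Type*} [CommRing F] {n p : ℕ} [NeZero p] (A : Tensor F n n p) : Prop :=
  ∃ X : Tensor F n n p, IsTInverse A X

/-- With respect to the partition `c` of `n` into consecutive blocks, only the diagonal blocks and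
the first superdiagonal blocks of `J` may be nonzero. (`c.index i` is the block containing `i`.) -/
def IsBlockBiDiagonalFor {F : Type*} [Zero F] {n : ℕ} (c : Composition n)
    (J : Matrix (Fin n) (Fin n) F) : Prop :=
  ∀ i j : Fin n, J i j ≠ 0 →
    (c.index j : ℕ) = (c.index i : ℕ) ∨ (c.index j : ℕ) = (c.index i : ℕ) + 1

/-- Upper block-bi-diagonal matrices: for some partition of `n` into parts equal to `1` or `2`, only
the diagonal and first superdiagonal blocks may be nonzero. -/
def IsUpperBlockBiDiagonal {F : Type*} [Zero F] {n : ℕ} (J : Matrix (Fin n) (Fin n) F) : Prop :=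
  ∃ c : Composition n, (∀ b ∈ c.blocks, b = 1 ∨ b = 2) ∧ IsBlockBiDiagonalFor c J

/-- A tensor is f-upper-block-bi-diagonal if each frontal slice is upper block-bi-diagonal. -/
def IsFUpperBlockBiDiagonal {F : Type*} [Zero F] {n p : ℕ} (J : Tensor F n n p) : Prop :=
  ∀ k : Fin p, IsUpperBlockBiDiagonal (J k)

end TProduct

/-!
The t-product is the matrix product over the group algebra `F[ℤ/p]`, so it suffices to bring a
matrix over this algebra to block-bi-diagonal form by a similarity. By Maschke's theorem the algebra
is a product of finite field extensions `K` of `F`, and the similarity may be chosen factor by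
factor, provided that one partition of `n` serves all factors.

If the algebraic closure of `F` has degree at most two over `F`, every irreducible polynomial `q`
over `K` has degree one or two. Expanding polynomials in powers of `q` gives a basis of
`K[X] ⧸ (q ^ e)` in which multiplication by `X` has diagonal blocks of size `deg q` coupled only to
the next ones. Listing the cyclic summands with `deg q = 2` first, their blocks fit the partition
`2 + 2 + ⋯`; the remaining part is upper bidiagonal and hence block-bi-diagonal for every partition.
The entries of the resulting matrix over `F[ℤ/p]` vanish outside the band, and therefore so do all
their coefficients, which form the frontal slices.
-/

namespace TProduct

open Polynomial Module DirectSum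

section PairComposition

/-- The partition `n = 2 + ⋯ + 2` or `n = 2 + ⋯ + 2 + 1`. It depends on `n` only, so it can be used
for all frontal slices simultaneously. -/
def pairComposition (n : ℕ) : Composition n where
  blocks := List.replicate (n / 2) 2 ++ List.replicate (n % 2) 1
  blocks_pos := by
    intro b hb
    simp only [List.mem_append, List.mem_replicate] at hb
    omega
  blocks_sum := by
    simp only [List.sum_append, List.sum_replicate, smul_eq_mul]
    omega

theorem eq_one_or_eq_two_of_mem_blocks_pairComposition {n b : ℕ}
    (hb : b ∈ (pairComposition n).blocks) : b = 1 ∨ b = 2 := by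
  simp only [pairComposition, List.mem_append, List.mem_replicate] at hb
  omega

theorem sizeUpTo_pairComposition (n i : ℕ) :
    (pairComposition n).sizeUpTo i = min i (n / 2) * 2 + min (i - n / 2) (n % 2) := by
  simp [Composition.sizeUpTo, pairComposition, List.take_append, List.take_replicate]

theorem index_pairComposition {n : ℕ} (j : Fin n) :
    ((pairComposition n).index j : ℕ) = j / 2 := by
  have hlower := (pairComposition n).sizeUpTo_index_le j
  have hupper := (pairComposition n).lt_sizeUpTo_index_succ j
  rw [sizeUpTo_pairComposition] at hlower hupper
  rw [Fin.val_succ] at hupper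
  omega

theorem isBlockBiDiagonalFor_pairComposition_iff {R : Type*} [Zero R] {n : ℕ}
    {J : Matrix (Fin n) (Fin n) R} :
    IsBlockBiDiagonalFor (pairComposition n) J ↔
      ∀ i j : Fin n, J i j ≠ 0 → (j : ℕ) / 2 = i / 2 ∨ (j : ℕ) / 2 = i / 2 + 1 := by
  simp only [IsBlockBiDiagonalFor, index_pairComposition]

end PairComposition

section Similarity

variable {n : ℕ} {c : Composition n}

/-- `A` is similar over `R` to a matrix that is upper block-bi-diagonal for the partition `c`. -/
def IsSimilarToBlockBiDiagonal {R : Type*} [Semiring R] (c : Composition n)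
    (A : Matrix (Fin n) (Fin n) R) : Prop :=
  ∃ J, IsBlockBiDiagonalFor c J ∧ IsConj J A

theorem IsSimilarToBlockBiDiagonal.map {R S : Type*} [Semiring R] [Semiring S]
    {A : Matrix (Fin n) (Fin n) R} (hA : IsSimilarToBlockBiDiagonal c A) (f : R →+* S) :
    IsSimilarToBlockBiDiagonal c (f.mapMatrix A) := by
  obtain ⟨J, hJ, hconj⟩ := hA
  refine ⟨f.mapMatrix J, fun i j hij => hJ i j fun hzero => hij ?_,
    f.mapMatrix.toMonoidHom.map_isConj hconj⟩
  rw [RingHom.mapMatrix_apply, Matrix.map_apply, hzero, map_zero]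

theorem isConj_pi {ι : Type*} {M : ι → Type*} [∀ t, Monoid (M t)] {a b : ∀ t, M t}
    (h : ∀ t, IsConj (a t) (b t)) : IsConj a b := by
  choose u hu using h
  exact ⟨MulEquiv.piUnits.symm u, funext hu⟩

theorem isSimilarToBlockBiDiagonal_pi {ι : Type*} {R : ι → Type*} [∀ t, Semiring (R t)]
    {A : Matrix (Fin n) (Fin n) (∀ t, R t)}
    (hA : ∀ t, IsSimilarToBlockBiDiagonal c (A.map fun x => x t)) :
    IsSimilarToBlockBiDiagonal c A := by
  choose J hJ hconj using hA
  let slices : Matrix (Fin n) (Fin n) (∀ t, R t) ≃+* ∀ t, Matrix (Fin n) (Fin n) (R t) :=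
    Matrix.piRingEquiv
  refine ⟨slices.symm J, fun i j hij => ?_,
    slices.symm.toRingHom.toMonoidHom.map_isConj (isConj_pi hconj)⟩
  obtain ⟨t, ht⟩ := Function.ne_iff.1 hij
  exact hJ t i j ht

theorem isSimilarToBlockBiDiagonal_of_forall_quotient {R : Type*} [CommRing R] [IsArtinianRing R]
    [IsReduced R] {A : Matrix (Fin n) (Fin n) R}
    (hA : ∀ I : MaximalSpectrum R,
      IsSimilarToBlockBiDiagonal c (A.map (Ideal.Quotient.mk I.asIdeal))) :
    IsSimilarToBlockBiDiagonal c A := by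
  let residues := (IsArtinianRing.equivPi R).toRingEquiv
  have hpi : IsSimilarToBlockBiDiagonal c (residues.toRingHom.mapMatrix A) :=
    isSimilarToBlockBiDiagonal_pi hA
  have hback : residues.symm.toRingHom.mapMatrix (residues.toRingHom.mapMatrix A) = A := by
    ext i j
    exact residues.symm_apply_apply (A i j)
  exact hback ▸ hpi.map residues.symm.toRingHom

end Similarity

section Chain

variable {F : Type*} [Field F] {q : F[X]} {e : ℕ}

/-- The polynomials `q ^ (e - 1 - k) * X ^ s` modulo `q ^ e`, indexed by the pairs `(k, s)` with
`k < e` and `s < natDegree q`. The exponent of `q` decreases with `k` in order that multiplication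
by `X` leads to the same or the preceding value of `k`, as required for upper bidiagonal blocks. -/
noncomputable def chainVector (q : F[X]) (e : ℕ) (a : Fin e × Fin q.natDegree) :
    F[X] ⧸ F[X] ∙ q ^ e :=
  Submodule.Quotient.mk (q ^ (a.1.rev : ℕ) * X ^ (a.2 : ℕ))

theorem mk_pow_rev_mul_mem_span_chainVector (k : Fin e) {r : F[X]}
    (hr : r.natDegree < q.natDegree) :
    (Submodule.Quotient.mk (q ^ (k.rev : ℕ) * r) : F[X] ⧸ F[X] ∙ q ^ e) ∈
      Submodule.span F (chainVector q e '' {b | b.1 = k}) := by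
  rw [r.as_sum_range' _ hr, Finset.mul_sum, ← Submodule.mkQ_apply, map_sum]
  refine Submodule.sum_mem _ fun s hs => ?_
  have hmonomial : q ^ (k.rev : ℕ) * monomial s (r.coeff s)
      = r.coeff s • (q ^ (k.rev : ℕ) * X ^ s) := by
    rw [← C_mul_X_pow_eq_monomial, ← smul_eq_C_mul, mul_smul_comm]
  rw [hmonomial, Submodule.mkQ_apply, Submodule.Quotient.mk_smul]
  exact Submodule.smul_mem _ _ (Submodule.subset_span ⟨(k, ⟨s, Finset.mem_range.1 hs⟩), rfl, rfl⟩)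

theorem span_range_chainVector (hq : 0 < q.natDegree) (e : ℕ) :
    Submodule.span F (Set.range (chainVector q e)) = ⊤ := by
  have hmem : ∀ m ≤ e, ∀ f : F[X], (Submodule.Quotient.mk (q ^ m * f) : F[X] ⧸ F[X] ∙ q ^ e) ∈
      Submodule.span F (Set.range (chainVector q e)) := by
    intro m hm
    induction hm using Nat.decreasingInduction with
    | self =>
      intro f
      rw [(Submodule.Quotient.mk_eq_zero _).2
        (Submodule.mem_span_singleton.2 ⟨f, by rw [smul_eq_mul, mul_comm]⟩)]
      exact Submodule.zero_mem _
    | of_succ m hm ih =>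
      intro f
      have hdiv : q ^ m * f = q ^ m * (f % q) + q ^ (m + 1) * (f / q) := by
        conv_lhs => rw [← EuclideanDomain.mod_add_div f q]
        ring
      rw [hdiv, Submodule.Quotient.mk_add]
      have hrem := mk_pow_rev_mul_mem_span_chainVector (Fin.rev ⟨m, hm⟩)
        (natDegree_mod_lt f hq.ne')
      rw [Fin.rev_rev] at hrem
      exact Submodule.add_mem _ (Submodule.span_mono (Set.image_subset_range _ _) hrem) (ih _)
  refine Submodule.eq_top_iff'.2 fun x => ?_
  obtain ⟨f, rfl⟩ := Submodule.Quotient.mk_surjective _ x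
  simpa only [pow_zero, one_mul] using hmem 0 e.zero_le f

theorem mk_pow_rev_succ_mem_span_chainVector (hq : 0 < q.natDegree) (k : Fin e) :
    (Submodule.Quotient.mk (q ^ (k.rev + 1 : ℕ)) : F[X] ⧸ F[X] ∙ q ^ e) ∈
      Submodule.span F (chainVector q e '' {b | (k : ℕ) = b.1 + 1}) := by
  obtain ⟨m, rfl⟩ : ∃ m, e = m + 1 := Nat.exists_eq_add_one.2 k.pos
  induction k using Fin.cases with
  | zero =>
    have hzero : (Submodule.Quotient.mk (q ^ (m + 1)) : F[X] ⧸ F[X] ∙ q ^ (m + 1)) = 0 :=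
      (Submodule.Quotient.mk_eq_zero _).2 (Submodule.mem_span_singleton_self _)
    rw [Fin.rev_zero, Fin.val_last, hzero]
    exact Submodule.zero_mem _
  | succ k =>
    have hprev := mk_pow_rev_mul_mem_span_chainVector (q := q) k.castSucc (r := 1)
      (by rwa [natDegree_one])
    rw [mul_one, Fin.rev_castSucc, Fin.val_succ] at hprev
    rw [Fin.rev_succ, Fin.val_castSucc]
    refine Submodule.span_mono (Set.image_mono fun b hb => ?_) hprev
    rw [Set.mem_ofPred_eq, show b.1 = k.castSucc from hb, Fin.val_succ, Fin.val_castSucc]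

theorem exists_div_eq_C_of_natDegree_le {f : F[X]} (hq : 0 < q.natDegree)
    (hf : f.natDegree ≤ q.natDegree) : ∃ u, f / q = C u := by
  have hq0 : q ≠ 0 := ne_zero_of_natDegree_gt hq
  refine ⟨_, eq_C_of_natDegree_eq_zero ?_⟩
  rw [div_def, natDegree_C_mul (inv_ne_zero (leadingCoeff_ne_zero.2 hq0)),
    natDegree_divByMonic _ (monic_mul_leadingCoeff_inv hq0), natDegree_mul_leadingCoeff_inv _ hq0,
    Nat.sub_eq_zero_of_le hf]

theorem X_smul_chainVector_mem_span (a : Fin e × Fin q.natDegree) :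
    (X : F[X]) • chainVector q e a ∈
      Submodule.span F (chainVector q e '' {b | (a.1 : ℕ) = b.1 ∨ (a.1 : ℕ) = b.1 + 1}) := by
  obtain ⟨k, s⟩ := a
  have hq : 0 < q.natDegree := s.pos
  obtain ⟨u, hu⟩ : ∃ u : F, X ^ (s + 1 : ℕ) / q = C u :=
    exists_div_eq_C_of_natDegree_le hq (by rw [natDegree_X_pow]; exact s.2)
  have hdiv : (X : F[X]) • chainVector q e (k, s) =
      Submodule.Quotient.mk (q ^ (k.rev : ℕ) * (X ^ (s + 1 : ℕ) % q)) +
        u • Submodule.Quotient.mk (q ^ (k.rev + 1 : ℕ)) := by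
    rw [chainVector, ← Submodule.Quotient.mk_smul, ← Submodule.Quotient.mk_smul,
      ← Submodule.Quotient.mk_add, EuclideanDomain.mod_eq_sub_mul_div, hu, smul_eq_C_mul,
      smul_eq_mul]
    congr 1
    ring
  have hsame := mk_pow_rev_mul_mem_span_chainVector k (natDegree_mod_lt (X ^ (s + 1 : ℕ)) hq.ne')
  have hprev := mk_pow_rev_succ_mem_span_chainVector hq k
  rw [hdiv]
  exact Submodule.add_mem _
    (Submodule.span_mono (Set.image_mono fun b hb => .inl (congrArg Fin.val hb.symm)) hsame)
    (Submodule.smul_mem _ _ (Submodule.span_mono (Set.image_mono fun b hb => .inr hb) hprev))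

theorem exists_basis_repr_X_smul_quotient_pow (hq : 0 < q.natDegree) (e : ℕ) :
    ∃ c : Basis (Fin e × Fin q.natDegree) F (F[X] ⧸ F[X] ∙ q ^ e), ∀ a b,
      c.repr ((X : F[X]) • c a) b ≠ 0 → (a.1 : ℕ) = b.1 ∨ (a.1 : ℕ) = b.1 + 1 := by
  have hcard : Fintype.card (Fin e × Fin q.natDegree) = finrank F (F[X] ⧸ F[X] ∙ q ^ e) := by
    rw [Fintype.card_prod, Fintype.card_fin, Fintype.card_fin, ← natDegree_pow]
    exact finrank_quotient_span_eq_natDegree.symm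
  let c := basisOfTopLeSpanOfCardEqFinrank _ (span_range_chainVector hq e).ge hcard
  have hc : ⇑c = chainVector q e := coe_basisOfTopLeSpanOfCardEqFinrank ..
  refine ⟨c, fun a b hab => ?_⟩
  have hmem := X_smul_chainVector_mem_span (e := e) a
  rw [← hc, Basis.mem_span_image] at hmem
  exact hmem (Finsupp.mem_support_iff.2 hab)

end Chain

section Field

universe u

variable {F : Type u} [Field F]

theorem exists_basis_primary_chains {V : Type*} [AddCommGroup V] [Module F V]
    [FiniteDimensional F V] (T : V →ₗ[F] V) :
    ∃ (ι : Type u) (_ : Finite ι) (q : ι → F[X]) (e : ι → ℕ)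
      (b : Basis (Σ i, Fin (e i) × Fin (q i).natDegree) F V),
      (∀ i, Irreducible (q i)) ∧ ∀ s t, b.repr (T (b t)) s ≠ 0 →
        t.1 = s.1 ∧ ((t.2.1 : ℕ) = s.2.1 ∨ (t.2.1 : ℕ) = s.2.1 + 1) := by
  classical
  obtain ⟨ι, _, q, hq, e, ⟨f⟩⟩ := Module.equiv_directSum_of_isTorsion
    (AEval.isTorsion_of_finiteDimensional F V T)
  choose c hc using fun i => exists_basis_repr_X_smul_quotient_pow (hq i).natDegree_pos (e i)
  let g : V ≃ₗ[F] ∀ i, F[X] ⧸ F[X] ∙ q i ^ e i :=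
    (AEval'.of T).trans
      ((f.trans (DirectSum.linearEquivFunOnFintype F[X] ι _)).restrictScalars F)
  have hg : ∀ v, g (T v) = (X : F[X]) • g v := fun v => by
    simp only [g, LinearEquiv.trans_apply, LinearEquiv.restrictScalars_apply, ← map_smul,
      AEval'.X_smul_of]
  refine ⟨ι, inferInstance, q, e, (Pi.basis c).map g.symm, hq, ?_⟩
  rintro ⟨i, a⟩ ⟨j, a'⟩ hst
  rw [Basis.map_repr, Basis.map_apply, LinearEquiv.trans_apply, LinearEquiv.symm_symm, hg,
    LinearEquiv.apply_symm_apply, Pi.basis_repr, Pi.basis_apply, Pi.smul_apply] at hst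
  obtain rfl : j = i := by
    by_contra hji
    exact hst (by rw [Pi.single_eq_of_ne' hji, smul_zero, map_zero, Finsupp.zero_apply])
  rw [Pi.single_eq_same] at hst
  exact ⟨rfl, hc j a' a hst⟩

theorem exists_equiv_fin_initial {ι : Type*} [Finite ι] (s : ι → Prop) :
    ∃ (N : ℕ) (ε : Fin N ≃ ι), ∀ i j, i ≤ j → s (ε j) → s (ε i) := by
  classical
  let enum := (Finite.equivFin ι).symm
  let k : Fin (Nat.card ι) → ℕ := fun i => if s (enum i) then 0 else 1
  refine ⟨_, (Tuple.sort k).trans enum, fun i j hij hj => ?_⟩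
  have hle := Tuple.monotone_sort k hij
  by_contra hi
  simp only [Equiv.trans_apply] at hi hj
  simp [k, hi, hj] at hle

theorem exists_equiv_fin_div_two {ι : Type*} [Finite ι] (e d : ι → ℕ)
    (hd : ∀ i, d i = 1 ∨ d i = 2) :
    ∃ (n : ℕ) (σ : (Σ i, Fin (e i) × Fin (d i)) ≃ Fin n),
      ∀ i (a b : Fin (e i) × Fin (d i)), ((b.1 : ℕ) = a.1 ∨ (b.1 : ℕ) = a.1 + 1) →
        (σ ⟨i, b⟩ : ℕ) / 2 = σ ⟨i, a⟩ / 2 ∨ (σ ⟨i, b⟩ : ℕ) / 2 = σ ⟨i, a⟩ / 2 + 1 := by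
  -- With the pairs first, each of them starts at an even position, and chains of singletons can be
  -- cut into pairs anywhere because one step moves the position by at most one.
  obtain ⟨N, ε, hε⟩ := exists_equiv_fin_initial fun i => d i = 2
  let concat : (Σ k, Fin (e (ε k)) × Fin (d (ε k))) ≃ Fin (∑ k, e (ε k) * d (ε k)) :=
    (Equiv.sigmaCongrRight fun _ => finProdFinEquiv).trans finSigmaFinEquiv
  let relabel : (Σ k, Fin (e (ε k)) × Fin (d (ε k))) ≃ Σ i, Fin (e i) × Fin (d i) :=
    Equiv.sigmaCongrLeft (β := fun i => Fin (e i) × Fin (d i)) ε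
  refine ⟨_, relabel.symm.trans concat, fun i a b hab => ?_⟩
  obtain ⟨k, rfl⟩ := ε.surjective i
  let offset := ∑ l : Fin k, e (ε (Fin.castLE k.2.le l)) * d (ε (Fin.castLE k.2.le l))
  have hposition : ∀ a : Fin (e (ε k)) × Fin (d (ε k)),
      (relabel.symm.trans concat ⟨ε k, a⟩ : ℕ) = offset + (a.2 + d (ε k) * a.1) := fun a => by
    have hrelabel : relabel.symm ⟨ε k, a⟩ = ⟨k, a⟩ := relabel.symm_apply_apply ⟨k, a⟩
    rw [Equiv.trans_apply, hrelabel]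
    exact finSigmaFinEquiv_apply _
  rw [hposition, hposition]
  have ha : (a.2 : ℕ) < d (ε k) := a.2.2
  have hb : (b.2 : ℕ) < d (ε k) := b.2.2
  rcases hd (ε k) with hone | htwo
  · simp only [hone] at ha hb ⊢
    omega
  · have hoffset : 2 ∣ offset := Finset.dvd_sum fun l _ =>
      (hε (Fin.castLE k.2.le l) k (Fin.le_def.2 l.2.le) htwo) ▸ Nat.dvd_mul_left ..
    simp only [htwo] at ha hb ⊢
    omega

theorem exists_basis_isBlockBiDiagonalFor_pairComposition {V : Type*} [AddCommGroup V] [Module F V]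
    [FiniteDimensional F V] (hF : ∀ q : F[X], Irreducible q → q.natDegree ≤ 2) {n : ℕ}
    (hn : finrank F V = n) (T : V →ₗ[F] V) :
    ∃ b : Basis (Fin n) F V,
      IsBlockBiDiagonalFor (pairComposition n) (LinearMap.toMatrix b b T) := by
  obtain ⟨ι, _, q, e, b, hq, hb⟩ := exists_basis_primary_chains T
  obtain ⟨m, σ, hσ⟩ := exists_equiv_fin_div_two e (fun i => (q i).natDegree) fun i => by
    have := hF _ (hq i)
    have := (hq i).natDegree_pos
    omega
  obtain rfl : m = n := by
    rw [← hn, finrank_eq_card_basis (b.reindex σ), Fintype.card_fin]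
  refine ⟨b.reindex σ, isBlockBiDiagonalFor_pairComposition_iff.2 fun x y hxy => ?_⟩
  rw [LinearMap.toMatrix_apply, Basis.repr_reindex_apply, Basis.reindex_apply] at hxy
  obtain ⟨⟨i, a⟩, rfl⟩ := σ.surjective x
  obtain ⟨⟨j, a'⟩, rfl⟩ := σ.surjective y
  rw [σ.symm_apply_apply, σ.symm_apply_apply] at hxy
  obtain ⟨rfl, hchain⟩ := hb _ _ hxy
  exact hσ j a a' hchain

theorem isSimilarToBlockBiDiagonal_of_irreducible_natDegree_le_two
    (hF : ∀ q : F[X], Irreducible q → q.natDegree ≤ 2) {n : ℕ} (A : Matrix (Fin n) (Fin n) F) :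
    IsSimilarToBlockBiDiagonal (pairComposition n) A := by
  obtain ⟨b, hb⟩ :=
    exists_basis_isBlockBiDiagonalFor_pairComposition hF (finrank_fin_fun F) A.toLin'
  let std := Pi.basisFun F (Fin n)
  have hA : LinearMap.toMatrix std std A.toLin' = A := by
    rw [LinearMap.toMatrix_eq_toMatrix', LinearMap.toMatrix'_toLin']
  let P : (Matrix (Fin n) (Fin n) F)ˣ :=
    ⟨std.toMatrix b, b.toMatrix std, std.toMatrix_mul_toMatrix_flip b,
      b.toMatrix_mul_toMatrix_flip std⟩
  refine ⟨_, hb, P, ?_⟩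
  calc std.toMatrix b * LinearMap.toMatrix b b A.toLin'
      = LinearMap.toMatrix b std A.toLin' := basis_toMatrix_mul_linearMap_toMatrix ..
    _ = LinearMap.toMatrix std std A.toLin' * std.toMatrix b :=
        (linearMap_toMatrix_mul_basis_toMatrix ..).symm
    _ = A * std.toMatrix b := by rw [hA]

end Field

section AlgebraicClosure

theorem natDegree_le_of_rank_algebraicClosure_le {F K : Type*} [Field F] [Field K] [Algebra F K]
    [Algebra.IsAlgebraic F K] {d : ℕ} (hF : Module.rank F (AlgebraicClosure F) ≤ d) {q : K[X]}
    (hq : Irreducible q) : q.natDegree ≤ d := by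
  have := Fact.mk hq
  have : Module.Finite K (AdjoinRoot q) := (AdjoinRoot.powerBasis hq.ne_zero).finite
  have : Algebra.IsAlgebraic F (AdjoinRoot q) := .trans F K _
  have hrank : Module.rank F (AdjoinRoot q) ≤ d := by
    have hinj : Function.Injective
        (IsAlgClosed.lift : AdjoinRoot q →ₐ[F] AlgebraicClosure F).toLinearMap :=
      RingHom.injective _
    simpa using (LinearMap.lift_rank_le_of_injective _ hinj).trans (Cardinal.lift_le.2 hF)
  have : Module.Finite F (AdjoinRoot q) :=
    Module.rank_lt_aleph0_iff.1 (hrank.trans_lt (Cardinal.natCast_lt_aleph0))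
  calc q.natDegree = finrank K (AdjoinRoot q) := finrank_quotient_span_eq_natDegree.symm
    _ ≤ finrank F (AdjoinRoot q) := finrank_top_le_finrank_of_isScalarTower F K _
    _ ≤ d := finrank_le_of_rank_le hrank

theorem isSimilarToBlockBiDiagonal_of_rank_algebraicClosure_le_two {F R : Type*} [Field F]
    [CommRing R] [IsReduced R] [Algebra F R] [Module.Finite F R]
    (hF : Module.rank F (AlgebraicClosure F) ≤ 2) {n : ℕ} (A : Matrix (Fin n) (Fin n) R) :
    IsSimilarToBlockBiDiagonal (pairComposition n) A := by
  have : IsArtinianRing R := IsArtinianRing.of_finite F R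
  refine isSimilarToBlockBiDiagonal_of_forall_quotient fun I => ?_
  let := Ideal.Quotient.field I.asIdeal
  exact isSimilarToBlockBiDiagonal_of_irreducible_natDegree_le_two
    (fun q hq => natDegree_le_of_rank_algebraicClosure_le hF hq) _

theorem rank_algebraicClosure_real : Module.rank ℝ (AlgebraicClosure ℝ) = 2 := by
  have : IsAlgClosure ℝ ℂ := ⟨inferInstance, inferInstance⟩
  rw [(IsAlgClosure.equiv ℝ (AlgebraicClosure ℝ) ℂ).toLinearEquiv.rank_eq,
    Complex.rank_real_complex]

end AlgebraicClosure

section GroupAlgebra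

theorem coeff_mul_eq_sum_sub {R G : Type*} [Semiring R] [AddGroup G] [Fintype G]
    (x y : AddMonoidAlgebra R G) (k : G) :
    (x * y).coeff k = ∑ l, x.coeff (k - l) * y.coeff l := by
  classical
  rw [AddMonoidAlgebra.coeff_mul, Finsupp.sum_fintype _ _ (by simp),
    Finset.sum_congr rfl fun i _ => Finsupp.sum_fintype _ _ (by simp), Finset.sum_comm]
  refine Finset.sum_congr rfl fun l _ => ?_
  simp_rw [← eq_sub_iff_add_eq]
  simp

variable {F : Type*} [CommRing F] {m n l p : ℕ}

/-- Tensors as matrices over the group algebra of `ℤ / p`: the tube `k ↦ A k i j` holds the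
coefficients of the `(i, j)` entry. The t-product corresponds to the matrix product. -/
noncomputable def groupAlgebraEquiv :
    Tensor F m n p ≃ Matrix (Fin m) (Fin n) (AddMonoidAlgebra F (Fin p)) where
  toFun A := Matrix.of fun i j => .ofCoeff (Finsupp.equivFunOnFinite.symm fun k => A k i j)
  invFun M := fun k => Matrix.of fun i j => (M i j).coeff k
  left_inv A := by
    ext
    simp
  right_inv M := by
    ext
    simp

@[simp]
theorem groupAlgebraEquiv_symm_apply (M : Matrix (Fin m) (Fin n) (AddMonoidAlgebra F (Fin p)))
    (k : Fin p) (i : Fin m) (j : Fin n) : groupAlgebraEquiv.symm M k i j = (M i j).coeff k :=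
  rfl

variable [NeZero p]

theorem groupAlgebraEquiv_symm_one :
    groupAlgebraEquiv.symm (1 : Matrix (Fin n) (Fin n) (AddMonoidAlgebra F (Fin p))) =
      tOne F n p := by
  ext k i j
  by_cases hk : k = 0 <;> by_cases hij : i = j <;>
    simp [tOne, hk, hij, Matrix.one_apply, AddMonoidAlgebra.one_def]

theorem groupAlgebraEquiv_symm_mul (M : Matrix (Fin m) (Fin n) (AddMonoidAlgebra F (Fin p)))
    (N : Matrix (Fin n) (Fin l) (AddMonoidAlgebra F (Fin p))) :
    groupAlgebraEquiv.symm (M * N) =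
      tProd (groupAlgebraEquiv.symm M) (groupAlgebraEquiv.symm N) := by
  ext k i j
  simp only [groupAlgebraEquiv_symm_apply, tProd, fold, bcirc, unfold, Matrix.mul_apply,
    Fintype.sum_prod_type, coeff_mul_eq_sum_sub, Matrix.of_apply, AddMonoidAlgebra.coeff_sum,
    Finsupp.finsetSum_apply]
  exact Finset.sum_comm

theorem isTInverse_groupAlgebraEquiv_symm
    (P : (Matrix (Fin n) (Fin n) (AddMonoidAlgebra F (Fin p)))ˣ) :
    IsTInverse (groupAlgebraEquiv.symm P.val) (groupAlgebraEquiv.symm P⁻¹.val) :=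
  ⟨by rw [← groupAlgebraEquiv_symm_mul, P.mul_inv, groupAlgebraEquiv_symm_one],
    by rw [← groupAlgebraEquiv_symm_mul, P.inv_mul, groupAlgebraEquiv_symm_one]⟩

theorem IsBlockBiDiagonalFor.groupAlgebraEquiv_symm {c : Composition n}
    {J : Matrix (Fin n) (Fin n) (AddMonoidAlgebra F (Fin p))} (hJ : IsBlockBiDiagonalFor c J)
    (k : Fin p) : IsBlockBiDiagonalFor c (groupAlgebraEquiv.symm J k) := fun i j hij =>
  hJ i j fun hzero => hij <| by simp [hzero]

end GroupAlgebra

end TProduct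

theorem mainTheorem3_general {F : Type*} [Field F]
    (hF : Module.rank F (AlgebraicClosure F) ≤ 2) (n p : ℕ) [NeZero p] [NeZero (p : F)]
    (A : TProduct.Tensor F n n p) :
    ∃ (P J Pinv : TProduct.Tensor F n n p) (c : Composition n),
      TProduct.IsTInverse P Pinv ∧ A = TProduct.tProd (TProduct.tProd P J) Pinv ∧
        (∀ b ∈ c.blocks, b = 1 ∨ b = 2) ∧ ∀ k, TProduct.IsBlockBiDiagonalFor c (J k) := by
  have : NeZero (Nat.card (Fin p) : F) := by rwa [Nat.card_fin]
  obtain ⟨J, hJ, P, hP⟩ :=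
    TProduct.isSimilarToBlockBiDiagonal_of_rank_algebraicClosure_le_two hF
      (TProduct.groupAlgebraEquiv A)
  have hA : TProduct.groupAlgebraEquiv A = P.val * J * P⁻¹.val := by
    rw [Units.eq_mul_inv_iff_mul_eq, hP.eq]
  refine ⟨_, TProduct.groupAlgebraEquiv.symm J, _, TProduct.pairComposition n,
    TProduct.isTInverse_groupAlgebraEquiv_symm P, ?_,
    fun _ => TProduct.eq_one_or_eq_two_of_mem_blocks_pairComposition, hJ.groupAlgebraEquiv_symm⟩
  rw [← TProduct.groupAlgebraEquiv_symm_mul, ← TProduct.groupAlgebraEquiv_symm_mul, ← hA,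
    Equiv.symm_apply_apply]

theorem mainTheorem3 (n p : ℕ) [NeZero p] (A : TProduct.Tensor ℝ n n p) :
    ∃ P J : TProduct.Tensor ℝ n n p,
      TProduct.IsTInvertible P ∧
      TProduct.IsFUpperBlockBiDiagonal J ∧
      (∃ Pinv : TProduct.Tensor ℝ n n p, TProduct.IsTInverse P Pinv ∧
        A = TProduct.tProd (TProduct.tProd P J) Pinv) ∧
      (∀ k : Fin p, ∃ c : Composition n,
        (∀ b ∈ c.blocks, b ≤ 2) ∧ TProduct.IsBlockBiDiagonalFor c (J k)) := by
  obtain ⟨P, J, Pinv, c, hP, hA, hc, hJ⟩ :=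
    mainTheorem3_general TProduct.rank_algebraicClosure_real.le n p A
  exact ⟨P, J, ⟨Pinv, hP⟩, fun k => ⟨c, hc, hJ k⟩, ⟨Pinv, hP, hA⟩,
    fun k => ⟨c, fun b hb => (hc b hb).elim (by omega) (by omega), hJ k⟩⟩
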